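/- Let $n,m\in\mathbb N$ and let $g_0=\sum_i\epsilon_i\,dx_i^2$ on $\mathbb R^n$ and $\tilde g_0=\sum_j\delta_j\,dy_j^2$ on $\mathbb R^m$ be semi-Euclidean metrics, $\epsilon_i,\delta_j\in\{1,-1\}$. Let $\alpha\in\mathbb R^n$ and $\beta\in\mathbb R^m$ be non-zero vectors, and put $\xi(x)=\sum_i\alpha_ix_i$, $\zeta(y)=\sum_j\beta_jy_j$ and $\|\alpha\|^2=\sum_i\epsilon_i\alpha_i^2$. Let $I,J\subseteq\mathbb R$ be non-empty open intervals (for instance $I=J=\mathbb R$), and let $\varphi,f,h:I\to\mathbb R$ and $\tau,u:J\to\mathbb R$ be smooth functions such that $\varphi$ and $\tau$ vanish nowhere, $f>0$, and $u$ is not constant. On the open set $M=\{(x,y)\in\mathbb R^n\times\mathbb R^m:\ \xi(x)\in I,\ \zeta(y)\in J\}$ (all of $\mathbb R^n\times\mathbb R^m$ if $I=J=\mathbb R$) consider the warped product metric $$g=\varphi(\xi)^{-2}g_0+f(\xi)^2\,\tau(\zeta)^{-2}\tilde g_0 .$$ Suppose that, for some $\lambda\in\mathbb R$, $(M,g)$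 is a gradient Ricci-harmonic soliton (GRHS) with potential function $h=h(\xi)$ and harmonic map $u=u(\zeta):M\to\mathbb R$, that is, there is a constant $\theta\ge 0$ such that on $M$ $$\mathrm{Ric}_g+\mathrm{Hess}_g h-\theta\,du\otimes du=\lambda g,\qquad \tau_g u-g(\nabla u,\nabla h)=0,$$ where $\tau_gu=\mathrm{trace}_g(\nabla du)$ is the tension field of $u$. If $\|\alpha\|^2=0$, then the soliton is steady, i.e. $\lambda=0$. -/

import Mathlib

open scoped ContDiff

noncomputable section

namespace GRHS

/-! ## Semi-Riemannian geometry in global coordinates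

Points are `x : ι → ℝ`, and a field of bilinear forms on an open set `U` of `ι → ℝ` is given by
its matrix of components `G x i j = g(∂ᵢ, ∂ⱼ)` at `x`. -/

section Coordinates

variable {ι : Type*} [Fintype ι] [DecidableEq ι]

/-- The partial derivative `∂ᵢ F` at `x`. -/
def pd (i : ι) (F : (ι → ℝ) → ℝ) (x : ι → ℝ) : ℝ :=
  fderiv ℝ F x (Pi.single i 1)

/-- `G` is a (smooth) semi-Riemannian metric on the set `U`, of any signature. -/
structure IsSemiRiemannianMetricOn (U : Set (ι → ℝ)) (G : (ι → ℝ) → Matrix ι ι ℝ) : Prop where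
  smooth : ∀ i j, ContDiffOn ℝ ∞ (fun x => G x i j) U
  symm : ∀ x ∈ U, (G x).IsSymm
  nondegenerate : ∀ x ∈ U, (G x).det ≠ 0

/-- The Christoffel symbol `Γᵏᵢⱼ` of the Levi-Civita connection of `G`. -/
def christoffel (G : (ι → ℝ) → Matrix ι ι ℝ) (k i j : ι) (x : ι → ℝ) : ℝ :=
  (1 / 2 : ℝ) * ∑ l, (G x)⁻¹ k l *
    (pd i (fun y => G y j l) x + pd j (fun y => G y i l) x - pd l (fun y => G y i j) x)

/-- The component `Ricᵢⱼ` of the Ricci tensor of `G` (positive on round spheres). -/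
def ricci (G : (ι → ℝ) → Matrix ι ι ℝ) (i j : ι) (x : ι → ℝ) : ℝ :=
  ∑ k, (pd k (christoffel G k i j) x - pd j (christoffel G k i k) x
    + ∑ l, (christoffel G k k l x * christoffel G l i j x
      - christoffel G k j l x * christoffel G l i k x))

/-- The component `(Hess F)ᵢⱼ = (∇dF)ᵢⱼ` of the Hessian of a function with respect to `G`. -/
def hess (G : (ι → ℝ) → Matrix ι ι ℝ) (F : (ι → ℝ) → ℝ) (i j : ι) (x : ι → ℝ) : ℝ :=
  pd i (pd j F) x - ∑ k, christoffel G k i j x * pd k F x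

/-- The tension field of a real function (target `(ℝ, dr²)`): the trace of `∇dF` under `G`. -/
def tension (G : (ι → ℝ) → Matrix ι ι ℝ) (F : (ι → ℝ) → ℝ) (x : ι → ℝ) : ℝ :=
  ∑ i, ∑ j, (G x)⁻¹ i j * hess G F i j x

/-- The function `g(∇F, ∇H)`. -/
def gradInner (G : (ι → ℝ) → Matrix ι ι ℝ) (F H : (ι → ℝ) → ℝ) (x : ι → ℝ) : ℝ :=
  ∑ i, ∑ j, (G x)⁻¹ i j * pd i F x * pd j H x

/-- `(U, G)` with potential function `h`, real-valued map `u` and constant `lam` is a gradient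
Ricci-harmonic soliton: for some constant `θ ≥ 0`, on `U`,
`Ric + Hess h - θ du ⊗ du = lam g` and `τ u - g(∇u, ∇h) = 0`. -/
structure IsGRHSOn (U : Set (ι → ℝ)) (G : (ι → ℝ) → Matrix ι ι ℝ) (h u : (ι → ℝ) → ℝ)
    (lam : ℝ) : Prop where
  isOpen : IsOpen U
  metric : IsSemiRiemannianMetricOn U G
  smooth_potential : ContDiffOn ℝ ∞ h U
  smooth_map : ContDiffOn ℝ ∞ u U
  equations : ∃ θ : ℝ, 0 ≤ θ ∧ ∀ x ∈ U,
    (∀ i j, ricci G i j x + hess G h i j x - θ * (pd i u x * pd j u x) = lam * G x i j) ∧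
    tension G u x - gradInner G u h x = 0

/-- The semi-Euclidean metric `(g₀)ᵢⱼ = εᵢ δᵢⱼ`. -/
def semiEuclidean (ε : ι → ℝ) : (ι → ℝ) → Matrix ι ι ℝ :=
  fun _ => Matrix.diagonal ε

/-- The conformal metric `ψ⁻² G`. -/
def conformal (ψ : (ι → ℝ) → ℝ) (G : (ι → ℝ) → Matrix ι ι ℝ) : (ι → ℝ) → Matrix ι ι ℝ :=
  fun x => ((ψ x) ^ 2)⁻¹ • G x

/-- The square `‖α‖² = ∑ᵢ εᵢ αᵢ²` in the semi-Euclidean metric with signs `ε`. -/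
def semiNormSq (ε α : ι → ℝ) : ℝ :=
  ∑ i, ε i * α i ^ 2

end Coordinates

/-- The projection of `ℝⁿ × ℝᵐ`, with coordinates indexed by `Fin n ⊕ Fin m`, to the base. -/
def toBase {n m : ℕ} (p : Fin n ⊕ Fin m → ℝ) : Fin n → ℝ := fun i => p (Sum.inl i)

/-- The projection of `ℝⁿ × ℝᵐ` to the fiber. -/
def toFiber {n m : ℕ} (p : Fin n ⊕ Fin m → ℝ) : Fin m → ℝ := fun i => p (Sum.inr i)

/-- The warped product metric `π^* gB + (f ∘ π)² σ^* gF`. -/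
def warped {n m : ℕ} (gB : (Fin n → ℝ) → Matrix (Fin n) (Fin n) ℝ) (f : (Fin n → ℝ) → ℝ)
    (gF : (Fin m → ℝ) → Matrix (Fin m) (Fin m) ℝ) :
    (Fin n ⊕ Fin m → ℝ) → Matrix (Fin n ⊕ Fin m) (Fin n ⊕ Fin m) ℝ :=
  fun p => Matrix.fromBlocks (gB (toBase p)) 0 0 ((f (toBase p)) ^ 2 • gF (toFiber p))

end GRHS

end

/-!
By O'Neill's formulas the component of the soliton equation along the base is
`Ric(g_B) - (m / f) Hess f + Hess h = λ g_B` with `g_B = φ(ξ)⁻² g₀`, since `u` does not depend on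
the base variables. For functions of `ξ` alone the conformal change formulas turn every term on the
left into a multiple of `dξ ⊗ dξ` plus a multiple of `‖α‖² g₀`. If `‖α‖² = 0`, only `dξ ⊗ dξ`
survives, whose `g₀`-trace is `‖α‖² = 0`, while `λ φ⁻² g₀` has `g₀`-trace `n λ φ⁻²`; hence `λ = 0`.
-/

open Filter Topology

namespace GRHS

section PartialDerivatives

variable {ι : Type*} [DecidableEq ι] {F H : (ι → ℝ) → ℝ} {x : ι → ℝ}

lemma pd_congr_of_eventuallyEq (h : F =ᶠ[𝓝 x] H) (i : ι) : pd i F x = pd i H x := by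
  rw [pd, pd, h.fderiv_eq]

lemma pd_const (i : ι) (c : ℝ) : pd i (fun _ => c) x = 0 := by
  simp [pd]

section Finite

variable [Finite ι]

lemma pd_eq_zero_of_forall_add_smul {i : ι} (h : ∀ t : ℝ, F (x + t • Pi.single i 1) = F x) :
    pd i F x = 0 := by
  cases nonempty_fintype ι
  by_cases hF : DifferentiableAt ℝ F x
  · simp [pd, ← hF.lineDeriv_eq_fderiv, lineDeriv, h]
  · simp [pd, fderiv_zero_of_not_differentiableAt hF]

lemma pd_add (hF : DifferentiableAt ℝ F x) (hH : DifferentiableAt ℝ H x) (i : ι) :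
    pd i (fun y => F y + H y) x = pd i F x + pd i H x := by
  cases nonempty_fintype ι
  simp [pd, fderiv_fun_add hF hH]

lemma pd_sub (hF : DifferentiableAt ℝ F x) (hH : DifferentiableAt ℝ H x) (i : ι) :
    pd i (fun y => F y - H y) x = pd i F x - pd i H x := by
  cases nonempty_fintype ι
  simp [pd, fderiv_fun_sub hF hH]

lemma pd_neg (i : ι) : pd i (fun y => -F y) x = -pd i F x := by
  cases nonempty_fintype ι
  simp [pd, fderiv_fun_neg]

lemma pd_mul (hF : DifferentiableAt ℝ F x) (hH : DifferentiableAt ℝ H x) (i : ι) :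
    pd i (fun y => F y * H y) x = pd i F x * H x + F x * pd i H x := by
  cases nonempty_fintype ι
  simp only [pd, fderiv_fun_mul hF hH, add_apply, smul_apply, smul_eq_mul]
  ring

lemma pd_mul_const (hF : DifferentiableAt ℝ F x) (c : ℝ) (i : ι) :
    pd i (fun y => F y * c) x = pd i F x * c := by
  cases nonempty_fintype ι
  simp [pd_mul hF (differentiableAt_const c), pd_const]

lemma pd_comp {A : ℝ → ℝ} {A' : ℝ} (hA : HasDerivAt A A' (F x)) (hF : DifferentiableAt ℝ F x)
    (i : ι) : pd i (fun y => A (F y)) x = A' * pd i F x := by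
  cases nonempty_fintype ι
  have h : HasFDerivAt (fun y => A (F y)) (A' • fderiv ℝ F x) x :=
    hA.comp_hasFDerivAt x hF.hasFDerivAt
  simp [pd, h.fderiv]

lemma pd_div (hF : DifferentiableAt ℝ F x) (hH : DifferentiableAt ℝ H x) (hx : H x ≠ 0) (i : ι) :
    pd i (fun y => F y / H y) x = (pd i F x * H x - F x * pd i H x) / H x ^ 2 := by
  cases nonempty_fintype ι
  simp_rw [div_eq_mul_inv (F _)]
  rw [pd_mul hF (hH.fun_inv hx), pd_comp (hasDerivAt_inv hx) hH]
  field_simp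
  ring

end Finite

variable [Fintype ι]

lemma differentiableAt_pd (hF : ContDiffAt ℝ 2 F x) (i : ι) : DifferentiableAt ℝ (pd i F) x :=
  ((hF.fderiv_right (m := 1) (by norm_num)).differentiableAt one_ne_zero).clm_apply
    (differentiableAt_const _)

lemma pd_pd_comm (hF : ContDiffAt ℝ 2 F x) (i j : ι) : pd i (pd j F) x = pd j (pd i F) x := by
  have hF' : DifferentiableAt ℝ (fderiv ℝ F) x :=
    (hF.fderiv_right (m := 1) (by norm_num)).differentiableAt one_ne_zero
  have pd_pd_eq (k l : ι) :
      pd k (pd l F) x = fderiv ℝ (fderiv ℝ F) x (Pi.single k 1) (Pi.single l 1) := by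
    change fderiv ℝ (fun y => fderiv ℝ F y (Pi.single l 1)) x (Pi.single k 1) = _
    simp [fderiv_clm_apply hF' (differentiableAt_const _)]
  rw [pd_pd_eq, pd_pd_eq]
  exact hF.isSymmSndFDerivAt (by simp) _ _

omit [DecidableEq ι] in
lemma differentiableAt_dotProduct (α : ι → ℝ) : DifferentiableAt ℝ (fun y => α ⬝ᵥ y) x := by
  unfold dotProduct
  fun_prop

lemma pd_dotProduct (α : ι → ℝ) (i : ι) : pd i (fun y => α ⬝ᵥ y) x = α i := by
  have h : HasFDerivAt (fun y => α ⬝ᵥ y)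
      (∑ j, α j • (ContinuousLinearMap.proj j : (ι → ℝ) →L[ℝ] ℝ)) x :=
    HasFDerivAt.fun_sum fun j _ => (hasFDerivAt_apply j x).const_mul (α j)
  simp [pd, h.fderiv, Pi.single_apply]

variable {α : ι → ℝ} {A : ℝ → ℝ}

omit [DecidableEq ι] in
lemma contDiffAt_comp_dotProduct {N : ℕ∞ω} (hA : ContDiffAt ℝ N A (α ⬝ᵥ x)) :
    ContDiffAt ℝ N (fun y => A (α ⬝ᵥ y)) x := by
  refine hA.comp x ?_
  unfold dotProduct
  fun_prop

lemma pd_comp_dotProduct (hA : DifferentiableAt ℝ A (α ⬝ᵥ x)) (i : ι) :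
    pd i (fun y => A (α ⬝ᵥ y)) x = deriv A (α ⬝ᵥ x) * α i := by
  rw [pd_comp hA.hasDerivAt (differentiableAt_dotProduct α), pd_dotProduct]

lemma pd_pd_comp_dotProduct (hA : ContDiffAt ℝ 2 A (α ⬝ᵥ x)) (i j : ι) :
    pd i (pd j fun y => A (α ⬝ᵥ y)) x = deriv (deriv A) (α ⬝ᵥ x) * (α i * α j) := by
  have hA' : DifferentiableAt ℝ (deriv A) (α ⬝ᵥ x) :=
    (hA.derivWithin (m := 1) (by norm_num)).differentiableAt one_ne_zero
  have h : pd j (fun y => A (α ⬝ᵥ y)) =ᶠ[𝓝 x] fun y => deriv A (α ⬝ᵥ y) * α j := by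
    filter_upwards [(differentiableAt_dotProduct α).continuousAt.eventually
      (hA.eventually (by simp))] with y hy
    exact pd_comp_dotProduct (hy.differentiableAt two_ne_zero) j
  rw [pd_congr_of_eventuallyEq h, pd_mul_const, pd_comp_dotProduct hA']
  · ring
  · exact hA'.comp x (differentiableAt_dotProduct α)

lemma christoffel_symm_of_isSemiRiemannianMetricOn {U : Set (ι → ℝ)}
    {G : (ι → ℝ) → Matrix ι ι ℝ} (hU : U ∈ 𝓝 x) (hG : IsSemiRiemannianMetricOn U G) (k i j : ι) :
    christoffel G k i j x = christoffel G k j i x := by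
  have h : (fun y => G y i j) =ᶠ[𝓝 x] fun y => G y j i := by
    filter_upwards [hU] with y hy using (hG.symm y hy).apply j i
  simp only [christoffel, fun l => pd_congr_of_eventuallyEq h l, add_comm]

end PartialDerivatives

section ConformallyFlat

variable {ι : Type*} [DecidableEq ι]

/-- The symbol `δᵏⱼ vᵢ + δᵏᵢ vⱼ - (g₀)ᵢⱼ εₖ vₖ` attached to a covector `v`. For
`v = -d(log ψ)` these are the Christoffel symbols of the conformally flat metric `ψ⁻² g₀`. -/
def conformalSymbol (ε v : ι → ℝ) (k i j : ι) : ℝ :=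
  (if k = j then v i else 0) + (if k = i then v j else 0) - Matrix.diagonal ε i j * (ε k * v k)

lemma conformalSymbol_comm (ε v : ι → ℝ) (k i j : ι) :
    conformalSymbol ε v k i j = conformalSymbol ε v k j i := by
  rw [conformalSymbol, conformalSymbol, ← Matrix.diagonal_transpose, Matrix.transpose_apply,
    Matrix.diagonal_transpose]
  ring

lemma pd_conformalSymbol [Finite ι] {ε x : ι → ℝ} {w : (ι → ℝ) → ι → ℝ}
    (hw : ∀ a, DifferentiableAt ℝ (fun y => w y a) x) (l k i j : ι) :
    pd l (fun y => conformalSymbol ε (w y) k i j) x =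
      conformalSymbol ε (fun a => pd l (fun y => w y a) x) k i j := by
  cases nonempty_fintype ι
  unfold conformalSymbol
  have hT : DifferentiableAt ℝ (fun y => ε k * w y k) x := (hw k).const_mul _
  split_ifs <;> simp [pd_sub, pd_add, pd_mul, pd_neg, pd_const, hw, hT]

variable [Fintype ι] {ε : ι → ℝ} {x : ι → ℝ}

lemma sum_conformalSymbol_mul (v c : ι → ℝ) (i j : ι) :
    ∑ k, conformalSymbol ε v k i j * c k =
      v i * c j + v j * c i - Matrix.diagonal ε i j * ∑ k, ε k * v k * c k := by
  simp [conformalSymbol, sub_mul, add_mul, Finset.sum_sub_distrib, Finset.sum_add_distrib,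
    Finset.mul_sum, mul_assoc]

lemma sum_conformalSymbol_trace (hε : ∀ i, ε i * ε i = 1) (v : ι → ℝ) (i : ι) :
    ∑ k, conformalSymbol ε v k i k = Fintype.card ι * v i := by
  simp [conformalSymbol, Matrix.diagonal_apply, Finset.sum_sub_distrib, Finset.sum_add_distrib,
    ← mul_assoc, hε]

lemma sum_mul_conformalSymbol (hε : ∀ i, ε i * ε i = 1) (v : ι → ℝ) (i j : ι) :
    ∑ k, ε k * v k * conformalSymbol ε v j i k = if i = j then semiNormSq ε v else 0 := by
  have hi : ε i * (v i * (ε i * (ε j * v j))) = ε j * (v j * v i) := by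
    linear_combination (v i * ε j * v j) * hε i
  rcases eq_or_ne i j with rfl | hij
  · simp [conformalSymbol, mul_sub, mul_add, Finset.sum_sub_distrib, Finset.sum_add_distrib,
      Matrix.diagonal_apply, semiNormSq, pow_two, mul_assoc, hi]
  · simp [conformalSymbol, mul_sub, Finset.sum_sub_distrib, Matrix.diagonal_apply, mul_assoc, hi,
      hij, hij.symm]

lemma sum_conformalSymbol_mul_conformalSymbol (hε : ∀ i, ε i * ε i = 1) (v : ι → ℝ) (i j : ι) :
    ∑ k, ∑ l, conformalSymbol ε v k j l * conformalSymbol ε v l i k =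
      (Fintype.card ι + 2) * (v i * v j) - 2 * Matrix.diagonal ε i j * semiNormSq ε v := by
  have inner_sum (k : ι) : ∑ l, conformalSymbol ε v k j l * conformalSymbol ε v l i k =
      v j * conformalSymbol ε v k i k
        + (if k = j then ∑ l, conformalSymbol ε v l i k * v l else 0)
        - ε j * (ε k * v k * conformalSymbol ε v j i k) := by
    have expand (l : ι) : conformalSymbol ε v k j l * conformalSymbol ε v l i k =
        (if k = l then v j * conformalSymbol ε v l i k else 0)
          + (if k = j then conformalSymbol ε v l i k * v l else 0)
          - (if j = l then ε j * (ε k * v k * conformalSymbol ε v l i k) else 0) := by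
      rw [conformalSymbol, Matrix.diagonal_apply]
      split_ifs <;> ring
    simp only [expand, Finset.sum_sub_distrib, Finset.sum_add_distrib, Finset.sum_ite_eq,
      Finset.mem_univ, if_true, Finset.sum_ite_irrel, Finset.sum_const_zero]
  simp only [inner_sum, Finset.sum_sub_distrib, Finset.sum_add_distrib, ← Finset.mul_sum,
    sum_conformalSymbol_trace hε, sum_mul_conformalSymbol hε, Finset.sum_ite_eq',
    Finset.mem_univ, if_true, sum_conformalSymbol_mul, Matrix.diagonal_apply]
  rcases eq_or_ne i j with rfl | hij
  · simp only [if_true, semiNormSq, pow_two, mul_assoc]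
    ring
  · simp only [hij, if_false, zero_mul, sub_zero, mul_zero]
    ring

lemma ricci_of_christoffel_eq_conformalSymbol (hε : ∀ i, ε i * ε i = 1)
    {G : (ι → ℝ) → Matrix ι ι ℝ} {w : (ι → ℝ) → ι → ℝ}
    (hG : ∀ᶠ y in 𝓝 x, ∀ k i j, christoffel G k i j y = conformalSymbol ε (w y) k i j)
    (hw : ∀ a, DifferentiableAt ℝ (fun y => w y a) x) (i j : ι) :
    ricci G i j x =
      pd i (fun y => w y j) x + (1 - Fintype.card ι) * pd j (fun y => w y i) x
        + (Fintype.card ι - 2) * (w x i * w x j)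
        - Matrix.diagonal ε i j * (∑ k, ε k * pd k (fun y => w y k) x
          + (Fintype.card ι - 2) * semiNormSq ε (w x)) := by
  have pd_christoffel (l k i j : ι) : pd l (christoffel G k i j) x =
      conformalSymbol ε (fun a => pd l (fun y => w y a) x) k i j := by
    rw [← pd_conformalSymbol hw]
    exact pd_congr_of_eventuallyEq (hG.mono fun y hy => hy k i j) l
  have trace_pd : ∑ k, pd k (christoffel G k i j) x =
      pd i (fun y => w y j) x + pd j (fun y => w y i) x
        - Matrix.diagonal ε i j * ∑ k, ε k * pd k (fun y => w y k) x := by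
    simp only [pd_christoffel]
    simp [conformalSymbol, Finset.sum_sub_distrib, Finset.sum_add_distrib, Finset.mul_sum, add_comm]
  have pd_trace : ∑ k, pd j (christoffel G k i k) x =
      Fintype.card ι * pd j (fun y => w y i) x := by
    simp only [pd_christoffel, sum_conformalSymbol_trace hε]
  have trace_mul : ∑ k, ∑ l, christoffel G k k l x * christoffel G l i j x =
      Fintype.card ι * (2 * (w x i * w x j)
        - Matrix.diagonal ε i j * semiNormSq ε (w x)) := by
    have trace (l : ι) : ∑ k, christoffel G k k l x = Fintype.card ι * w x l := by
      simp only [hG.self_of_nhds, conformalSymbol_comm ε _ _ _ l, sum_conformalSymbol_trace hε]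
    calc
      _ = ∑ l, (∑ k, christoffel G k k l x) * christoffel G l i j x := by
        rw [Finset.sum_comm]
        simp only [Finset.sum_mul]
      _ = Fintype.card ι * ∑ l, conformalSymbol ε (w x) l i j * w x l := by
        rw [Finset.mul_sum]
        exact Finset.sum_congr rfl fun l _ => by rw [trace, hG.self_of_nhds]; ring
      _ = _ := by
        simp only [sum_conformalSymbol_mul, semiNormSq, pow_two, mul_assoc]
        ring
  have mul_mul : ∑ k, ∑ l, christoffel G k j l x * christoffel G l i k x =
      (Fintype.card ι + 2) * (w x i * w x j)
        - 2 * Matrix.diagonal ε i j * semiNormSq ε (w x) := by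
    simp only [hG.self_of_nhds, sum_conformalSymbol_mul_conformalSymbol hε]
  simp only [ricci, Finset.sum_add_distrib, Finset.sum_sub_distrib, trace_pd, pd_trace, trace_mul,
    mul_mul]
  ring

variable {ψ : (ι → ℝ) → ℝ}

omit [Fintype ι] in
lemma conformal_semiEuclidean_apply (i j : ι) :
    conformal ψ (semiEuclidean ε) x i j = (ψ x ^ 2)⁻¹ * Matrix.diagonal ε i j := by
  simp [conformal, semiEuclidean]

lemma conformal_semiEuclidean_inv (hε : ∀ i, ε i * ε i = 1) (hψ : ψ x ≠ 0) :
    (conformal ψ (semiEuclidean ε) x)⁻¹ = ψ x ^ 2 • Matrix.diagonal ε := by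
  refine Matrix.inv_eq_right_inv ?_
  simp [conformal, semiEuclidean, hε, hψ, smul_smul]

lemma christoffel_conformal_semiEuclidean (hε : ∀ i, ε i * ε i = 1)
    (hψ : DifferentiableAt ℝ ψ x) (hψ₀ : ψ x ≠ 0) (k i j : ι) :
    christoffel (conformal ψ (semiEuclidean ε)) k i j x =
      conformalSymbol ε (fun a => -(pd a ψ x / ψ x)) k i j := by
  have pd_conformal (l a b : ι) :
      pd l (fun y => conformal ψ (semiEuclidean ε) y a b) x =
        -2 * (pd l ψ x / ψ x) * (ψ x ^ 2)⁻¹ * Matrix.diagonal ε a b := by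
    have hinv : HasDerivAt (fun s : ℝ => (s ^ 2)⁻¹) (-2 * (ψ x)⁻¹ * (ψ x ^ 2)⁻¹) (ψ x) := by
      convert! (hasDerivAt_pow 2 (ψ x)).fun_inv (pow_ne_zero 2 hψ₀) using 1
      field_simp
      norm_num
    simp only [conformal_semiEuclidean_apply]
    rw [pd_mul_const (F := fun y => (ψ y ^ 2)⁻¹) (hinv.differentiableAt.comp x hψ), pd_comp hinv hψ]
    ring
  have sum_eq (c : ι → ℝ) :
      ∑ l, (ψ x ^ 2 • Matrix.diagonal ε) k l * c l = ψ x ^ 2 * (ε k * c k) := by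
    simp [Matrix.diagonal_apply, mul_assoc]
  have sign_mul (a : ι) (c : ℝ) : ε k * (c * Matrix.diagonal ε a k) = if k = a then c else 0 := by
    rcases eq_or_ne k a with rfl | hka
    · simp [mul_left_comm _ c, hε]
    · simp [hka, hka.symm]
  simp only [christoffel, conformal_semiEuclidean_inv hε hψ₀, pd_conformal, sum_eq, conformalSymbol]
  linear_combination sign_mul j (-(pd i ψ x / ψ x)) + sign_mul i (-(pd j ψ x / ψ x))
    + ε k * (pd k ψ x / ψ x * Matrix.diagonal ε i j - pd i ψ x / ψ x * Matrix.diagonal ε j k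
      - pd j ψ x / ψ x * Matrix.diagonal ε i k) * mul_inv_cancel₀ (pow_ne_zero 2 hψ₀)

lemma hess_conformal_semiEuclidean (hε : ∀ i, ε i * ε i = 1) (hψ : DifferentiableAt ℝ ψ x)
    (hψ₀ : ψ x ≠ 0) (F : (ι → ℝ) → ℝ) (i j : ι) :
    hess (conformal ψ (semiEuclidean ε)) F i j x =
      pd i (pd j F) x + (pd i ψ x * pd j F x + pd j ψ x * pd i F x) / ψ x
        - Matrix.diagonal ε i j * (∑ k, ε k * pd k ψ x * pd k F x) / ψ x := by
  simp only [hess, christoffel_conformal_semiEuclidean hε hψ hψ₀, sum_conformalSymbol_mul]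
  have sum_eq : ∑ k, ε k * -(pd k ψ x / ψ x) * pd k F x =
      -((∑ k, ε k * pd k ψ x * pd k F x) / ψ x) := by
    rw [Finset.sum_div, ← Finset.sum_neg_distrib]
    exact Finset.sum_congr rfl fun k _ => by ring
  rw [sum_eq]
  ring

lemma ricci_conformal_semiEuclidean (hε : ∀ i, ε i * ε i = 1) (hψ : ContDiffAt ℝ 2 ψ x)
    (hψ₀ : ψ x ≠ 0) (i j : ι) :
    ricci (conformal ψ (semiEuclidean ε)) i j x =
      (Fintype.card ι - 2) * pd i (pd j ψ) x / ψ x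
        + Matrix.diagonal ε i j * ((∑ k, ε k * pd k (pd k ψ) x) / ψ x
          - (Fintype.card ι - 1) * semiNormSq ε (fun k => pd k ψ x) / ψ x ^ 2) := by
  have hψ' : DifferentiableAt ℝ ψ x := hψ.differentiableAt two_ne_zero
  have hΓ : ∀ᶠ y in 𝓝 x, ∀ k i j, christoffel (conformal ψ (semiEuclidean ε)) k i j y =
      conformalSymbol ε (fun a => -(pd a ψ y / ψ y)) k i j := by
    filter_upwards [hψ.eventually (by simp), hψ.continuousAt.eventually_ne hψ₀] with y hy hy₀
    exact christoffel_conformal_semiEuclidean hε (hy.differentiableAt two_ne_zero) hy₀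
  have hw (a : ι) : DifferentiableAt ℝ (fun y => -(pd a ψ y / ψ y)) x := by
    have := differentiableAt_pd hψ a
    fun_prop (disch := exact hψ₀)
  have pd_w (l a : ι) : pd l (fun y => -(pd a ψ y / ψ y)) x =
      pd l ψ x * pd a ψ x / ψ x ^ 2 - pd l (pd a ψ) x / ψ x := by
    rw [pd_neg, pd_div (differentiableAt_pd hψ a) hψ' hψ₀]
    field_simp
    ring
  rw [ricci_of_christoffel_eq_conformalSymbol hε hΓ hw]
  have sum_pd_w : ∑ k, ε k * (pd k ψ x * pd k ψ x / ψ x ^ 2 - pd k (pd k ψ) x / ψ x) =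
      semiNormSq ε (fun k => pd k ψ x) / ψ x ^ 2 - (∑ k, ε k * pd k (pd k ψ) x) / ψ x := by
    rw [semiNormSq, Finset.sum_div, Finset.sum_div, ← Finset.sum_sub_distrib]
    exact Finset.sum_congr rfl fun k _ => by ring
  have semiNormSq_w : semiNormSq ε (fun k => -(pd k ψ x / ψ x)) =
      semiNormSq ε (fun k => pd k ψ x) / ψ x ^ 2 := by
    rw [semiNormSq, semiNormSq, Finset.sum_div]
    exact Finset.sum_congr rfl fun k _ => by ring
  simp only [pd_w, pd_pd_comm hψ j i, sum_pd_w, semiNormSq_w]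
  ring

variable {α : ι → ℝ} {φ h : ℝ → ℝ}

lemma hess_conformal_comp_dotProduct (hε : ∀ i, ε i * ε i = 1)
    (hφ : DifferentiableAt ℝ φ (α ⬝ᵥ x)) (hφ₀ : φ (α ⬝ᵥ x) ≠ 0)
    (hh : ContDiffAt ℝ 2 h (α ⬝ᵥ x)) (i j : ι) :
    hess (conformal (fun y => φ (α ⬝ᵥ y)) (semiEuclidean ε)) (fun y => h (α ⬝ᵥ y)) i j x =
      (deriv (deriv h) (α ⬝ᵥ x) + 2 * deriv φ (α ⬝ᵥ x) * deriv h (α ⬝ᵥ x) / φ (α ⬝ᵥ x))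
          * (α i * α j)
        - deriv φ (α ⬝ᵥ x) * deriv h (α ⬝ᵥ x) / φ (α ⬝ᵥ x) * semiNormSq ε α
          * Matrix.diagonal ε i j := by
  have hh' : DifferentiableAt ℝ h (α ⬝ᵥ x) := hh.differentiableAt two_ne_zero
  have sum_eq (a b : ℝ) : ∑ k, ε k * (a * α k) * (b * α k) = a * b * semiNormSq ε α := by
    rw [semiNormSq, Finset.mul_sum]
    exact Finset.sum_congr rfl fun k _ => by ring
  rw [hess_conformal_semiEuclidean hε (hφ.fun_comp' x (differentiableAt_dotProduct α)) hφ₀]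
  simp only [pd_pd_comp_dotProduct hh, pd_comp_dotProduct hφ, pd_comp_dotProduct hh', sum_eq]
  ring

lemma ricci_conformal_comp_dotProduct (hε : ∀ i, ε i * ε i = 1)
    (hφ : ContDiffAt ℝ 2 φ (α ⬝ᵥ x)) (hφ₀ : φ (α ⬝ᵥ x) ≠ 0) (i j : ι) :
    ricci (conformal (fun y => φ (α ⬝ᵥ y)) (semiEuclidean ε)) i j x =
      (Fintype.card ι - 2) * deriv (deriv φ) (α ⬝ᵥ x) / φ (α ⬝ᵥ x) * (α i * α j)
        + (deriv (deriv φ) (α ⬝ᵥ x) / φ (α ⬝ᵥ x)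
            - (Fintype.card ι - 1) * (deriv φ (α ⬝ᵥ x) / φ (α ⬝ᵥ x)) ^ 2)
          * semiNormSq ε α * Matrix.diagonal ε i j := by
  have hφ' : DifferentiableAt ℝ φ (α ⬝ᵥ x) := hφ.differentiableAt two_ne_zero
  have sum_eq (c : ℝ) : ∑ k, ε k * (c * (α k * α k)) = c * semiNormSq ε α := by
    rw [semiNormSq, Finset.mul_sum]
    exact Finset.sum_congr rfl fun k _ => by ring
  have semiNormSq_smul (c : ℝ) : semiNormSq ε (fun k => c * α k) = c ^ 2 * semiNormSq ε α := by
    rw [semiNormSq, semiNormSq, Finset.mul_sum]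
    exact Finset.sum_congr rfl fun k _ => by ring
  rw [ricci_conformal_semiEuclidean hε (contDiffAt_comp_dotProduct hφ) hφ₀]
  simp only [pd_pd_comp_dotProduct hφ, pd_comp_dotProduct hφ', sum_eq, semiNormSq_smul]
  ring

end ConformallyFlat

section CurvatureTerm

variable {ι : Type*} [Fintype ι] [DecidableEq ι]

/-- The component `Rᵏᵢₖⱼ` of the curvature tensor of `G`, whose trace over `k` is `Ricᵢⱼ`. In a
warped product the base and the fiber directions `k` contribute to this trace separately. -/
noncomputable def curvatureTerm (G : (ι → ℝ) → Matrix ι ι ℝ) (k i j : ι) (x : ι → ℝ) : ℝ :=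
  pd k (christoffel G k i j) x - pd j (christoffel G k i k) x
    + ∑ l, (christoffel G k k l x * christoffel G l i j x
      - christoffel G k j l x * christoffel G l i k x)

lemma ricci_eq_sum_curvatureTerm (G : (ι → ℝ) → Matrix ι ι ℝ) (i j : ι) (x : ι → ℝ) :
    ricci G i j x = ∑ k, curvatureTerm G k i j x :=
  rfl

end CurvatureTerm

section WarpedProduct

variable {n m : ℕ} {p : Fin n ⊕ Fin m → ℝ}

lemma differentiableAt_toBase : DifferentiableAt ℝ (toBase (n := n) (m := m)) p :=
  differentiableAt_pi.2 fun i => differentiableAt_apply (Sum.inl i) p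

lemma sumElim_toBase_toFiber : Sum.elim (toBase p) (toFiber p) = p :=
  Sum.elim_comp_inl_inr p

lemma differentiableAt_slice {F : (Fin n ⊕ Fin m → ℝ) → ℝ} (hF : DifferentiableAt ℝ F p) :
    DifferentiableAt ℝ (fun x => F (Sum.elim x (toFiber p))) (toBase p) := by
  have hinclusion : DifferentiableAt ℝ (fun x => Sum.elim x (toFiber p)) (toBase p) := by
    refine differentiableAt_pi.2 ?_
    rintro (i | j)
    · exact differentiableAt_apply i (toBase p)
    · exact differentiableAt_const _
  exact DifferentiableAt.fun_comp' (f := fun x => Sum.elim x (toFiber p)) (toBase p)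
    (by rwa [sumElim_toBase_toFiber]) hinclusion

lemma pd_inl_eq_pd_slice {F : (Fin n ⊕ Fin m → ℝ) → ℝ} (hF : DifferentiableAt ℝ F p) (i : Fin n) :
    pd (Sum.inl i) F p = pd i (fun x => F (Sum.elim x (toFiber p))) (toBase p) := by
  rw [pd, pd, ← hF.lineDeriv_eq_fderiv, ← (differentiableAt_slice hF).lineDeriv_eq_fderiv,
    lineDeriv, lineDeriv]
  congr with t
  congr with (a | b) <;> simp [toBase, toFiber, Pi.single_apply]

lemma pd_inl_comp_toBase (F : (Fin n → ℝ) → ℝ) (i : Fin n) :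
    pd (Sum.inl i) (fun q => F (toBase q)) p = pd i F (toBase p) := by
  by_cases hF : DifferentiableAt ℝ F (toBase p)
  · exact pd_inl_eq_pd_slice (hF.fun_comp' p differentiableAt_toBase) i
  · have hF' : ¬ DifferentiableAt ℝ (fun q => F (toBase q)) p :=
      fun h => hF (differentiableAt_slice h)
    simp [pd, fderiv_zero_of_not_differentiableAt hF, fderiv_zero_of_not_differentiableAt hF']

lemma pd_inr_comp_toBase (F : (Fin n → ℝ) → ℝ) (j : Fin m) :
    pd (Sum.inr j) (fun q => F (toBase q)) p = 0 :=
  pd_eq_zero_of_forall_add_smul fun t => congrArg F (funext fun a => by simp [toBase])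

lemma pd_inl_comp_toFiber (F : (Fin m → ℝ) → ℝ) (i : Fin n) :
    pd (Sum.inl i) (fun q => F (toFiber q)) p = 0 :=
  pd_eq_zero_of_forall_add_smul fun t => congrArg F (funext fun b => by simp [toFiber])

variable {gB : (Fin n → ℝ) → Matrix (Fin n) (Fin n) ℝ} {f : (Fin n → ℝ) → ℝ}
  {gF : (Fin m → ℝ) → Matrix (Fin m) (Fin m) ℝ} {U : Set (Fin n ⊕ Fin m → ℝ)}

lemma warped_inv (hdet : (warped gB f gF p).det ≠ 0) :
    (warped gB f gF p)⁻¹ = Matrix.fromBlocks (gB (toBase p))⁻¹ 0 0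
      (f (toBase p) ^ 2 • gF (toFiber p))⁻¹ := by
  rw [warped, Matrix.det_fromBlocks_zero₂₁, mul_ne_zero_iff] at hdet
  rw [warped, Matrix.inv_fromBlocks_zero₂₁_of_isUnit_iff]
  · simp
  · simp only [Matrix.isUnit_iff_isUnit_det, hdet.1.isUnit, hdet.2.isUnit]

lemma christoffel_warped_inl_inl_inl (hdet : (warped gB f gF p).det ≠ 0) (k i j : Fin n) :
    christoffel (warped gB f gF) (Sum.inl k) (Sum.inl i) (Sum.inl j) p =
      christoffel gB k i j (toBase p) := by
  have pd_inl_base (a b c : Fin n) :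
      pd (Sum.inl a) (fun q => warped gB f gF q (Sum.inl b) (Sum.inl c)) p =
        pd a (fun x => gB x b c) (toBase p) :=
    pd_inl_comp_toBase (fun x => gB x b c) a
  simp [christoffel, warped_inv hdet, pd_inl_base]

lemma christoffel_warped_inr_inl_inl (hdet : (warped gB f gF p).det ≠ 0) (k : Fin m)
    (i j : Fin n) :
    christoffel (warped gB f gF) (Sum.inr k) (Sum.inl i) (Sum.inl j) p = 0 := by
  have pd_inr_base (a : Fin m) :
      pd (Sum.inr a) (fun q => warped gB f gF q (Sum.inl i) (Sum.inl j)) p = 0 :=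
    pd_inr_comp_toBase (fun x => gB x i j) a
  have pd_mixed (a : Fin n ⊕ Fin m) (b : Fin n) (c : Fin m) :
      pd a (fun q => warped gB f gF q (Sum.inl b) (Sum.inr c)) p = 0 := pd_const a 0
  simp [christoffel, warped_inv hdet, pd_inr_base, pd_mixed]

lemma pd_inl_warped_inr (hU : U ∈ 𝓝 p) (hG : IsSemiRiemannianMetricOn U (warped gB f gF))
    (hf : DifferentiableAt ℝ f (toBase p)) (i : Fin n) (j : Fin m) (l : Fin n ⊕ Fin m) :
    pd (Sum.inl i) (fun q => warped gB f gF q (Sum.inr j) l) p =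
      2 * (pd i f (toBase p) / f (toBase p)) * warped gB f gF p (Sum.inr j) l := by
  rcases l with l | l
  · simpa [warped] using pd_const (Sum.inl i) 0
  · rw [pd_inl_eq_pd_slice
      (((hG.smooth _ _).contDiffAt hU).differentiableAt (by simp))]
    have slice_eq : (fun x => warped gB f gF (Sum.elim x (toFiber p)) (Sum.inr j) (Sum.inr l)) =
        fun x => f x ^ 2 * gF (toFiber p) j l := rfl
    rw [slice_eq, pd_mul_const (F := fun x => f x ^ 2) (hf.pow 2), pd_comp (hasDerivAt_pow 2 _) hf]
    simp only [warped, Matrix.fromBlocks_apply₂₂, Matrix.smul_apply, smul_eq_mul]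
    field_simp
    push_cast
    ring

lemma christoffel_warped_inl_inr (hU : U ∈ 𝓝 p)
    (hG : IsSemiRiemannianMetricOn U (warped gB f gF)) (hf : DifferentiableAt ℝ f (toBase p))
    (k : Fin n ⊕ Fin m) (i : Fin n) (j : Fin m) :
    christoffel (warped gB f gF) k (Sum.inl i) (Sum.inr j) p =
      if k = Sum.inr j then pd i f (toBase p) / f (toBase p) else 0 := by
  have hp : p ∈ U := mem_of_mem_nhds hU
  have pd_inl_row (l : Fin n ⊕ Fin m) :
      pd (Sum.inl i) (fun q => warped gB f gF q (Sum.inr j) l) p =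
        2 * (pd i f (toBase p) / f (toBase p)) * warped gB f gF p l (Sum.inr j) := by
    rw [pd_inl_warped_inr hU hG hf, (hG.symm p hp).apply]
  have pd_inr_row (l : Fin n ⊕ Fin m) :
      pd (Sum.inr j) (fun q => warped gB f gF q (Sum.inl i) l) p = 0 := by
    rcases l with l | _
    · exact pd_inr_comp_toBase (fun x => gB x i l) j
    · exact pd_const _ 0
  have pd_mixed (l : Fin n ⊕ Fin m) :
      pd l (fun q => warped gB f gF q (Sum.inl i) (Sum.inr j)) p = 0 := pd_const l 0
  have inv_mul : ∑ l, (warped gB f gF p)⁻¹ k l * warped gB f gF p l (Sum.inr j) =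
      if k = Sum.inr j then 1 else 0 := by
    rw [← Matrix.mul_apply, Matrix.nonsing_inv_mul _ (hG.nondegenerate p hp).isUnit,
      Matrix.one_apply]
  simp only [christoffel, pd_inl_row, pd_inr_row, pd_mixed, add_zero, sub_zero,
    mul_left_comm _ (2 * (pd i f (toBase p) / f (toBase p))), ← Finset.mul_sum, inv_mul]
  split_ifs <;> ring

lemma eventually_christoffel_warped_inl_inr (hU : U ∈ 𝓝 p)
    (hG : IsSemiRiemannianMetricOn U (warped gB f gF)) (hf : ContDiffAt ℝ 1 f (toBase p)) :
    ∀ᶠ q in 𝓝 p, ∀ k i j, christoffel (warped gB f gF) k (Sum.inl i) (Sum.inr j) q =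
      if k = Sum.inr j then pd i f (toBase q) / f (toBase q) else 0 := by
  have htoBase : Tendsto toBase (𝓝 p) (𝓝 (toBase p)) := differentiableAt_toBase.continuousAt
  filter_upwards [eventually_mem_nhds_iff.2 hU,
    htoBase.eventually (hf.eventually (by simp))] with q hq hfq
  exact christoffel_warped_inl_inr hq hG (hfq.differentiableAt one_ne_zero)

lemma hess_warped_inl_inl (hdet : (warped gB f gF p).det ≠ 0) (F : (Fin n → ℝ) → ℝ)
    (i j : Fin n) :
    hess (warped gB f gF) (fun q => F (toBase q)) (Sum.inl i) (Sum.inl j) p =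
      hess gB F i j (toBase p) := by
  have pd_F : pd (Sum.inl j) (fun q : Fin n ⊕ Fin m → ℝ => F (toBase q)) =
      fun q => pd j F (toBase q) := funext fun q => pd_inl_comp_toBase F j
  simp [hess, pd_F, pd_inl_comp_toBase, pd_inr_comp_toBase, christoffel_warped_inl_inl_inl hdet]

lemma eventually_det_warped_ne_zero (hU : U ∈ 𝓝 p)
    (hG : IsSemiRiemannianMetricOn U (warped gB f gF)) :
    ∀ᶠ q in 𝓝 p, (warped gB f gF q).det ≠ 0 := by
  filter_upwards [hU] using hG.nondegenerate

lemma curvatureTerm_warped_inl (hU : U ∈ 𝓝 p)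
    (hG : IsSemiRiemannianMetricOn U (warped gB f gF)) (hf : DifferentiableAt ℝ f (toBase p))
    (k i j : Fin n) :
    curvatureTerm (warped gB f gF) (Sum.inl k) (Sum.inl i) (Sum.inl j) p =
      curvatureTerm gB k i j (toBase p) := by
  have hdet := eventually_det_warped_ne_zero hU hG
  have pd_base (l k i j : Fin n) :
      pd (Sum.inl l) (christoffel (warped gB f gF) (Sum.inl k) (Sum.inl i) (Sum.inl j)) p =
        pd l (christoffel gB k i j) (toBase p) := by
    rw [← pd_inl_comp_toBase]
    exact pd_congr_of_eventuallyEq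
      (hdet.mono fun q hq => christoffel_warped_inl_inl_inl hq k i j) _
  simp [curvatureTerm, pd_base, christoffel_warped_inl_inl_inl hdet.self_of_nhds,
    christoffel_warped_inl_inr hU hG hf]

lemma curvatureTerm_warped_inr (hU : U ∈ 𝓝 p)
    (hG : IsSemiRiemannianMetricOn U (warped gB f gF)) (hf : ContDiffAt ℝ 2 f (toBase p))
    (hf₀ : f (toBase p) ≠ 0) (k : Fin m) (i j : Fin n) :
    curvatureTerm (warped gB f gF) (Sum.inr k) (Sum.inl i) (Sum.inl j) p =
      -(hess gB f i j (toBase p) / f (toBase p)) := by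
  have hf' : DifferentiableAt ℝ f (toBase p) := hf.differentiableAt two_ne_zero
  have hdet := eventually_det_warped_ne_zero hU hG
  have hdet' := hdet.self_of_nhds
  have pd_fiber :
      pd (Sum.inr k) (christoffel (warped gB f gF) (Sum.inr k) (Sum.inl i) (Sum.inl j)) p = 0 := by
    rw [pd_congr_of_eventuallyEq
      (hdet.mono fun q hq => christoffel_warped_inr_inl_inl hq k i j), pd_const]
  have pd_mixed :
      pd (Sum.inl j) (christoffel (warped gB f gF) (Sum.inr k) (Sum.inl i) (Sum.inr k)) p =
        pd j (fun x => pd i f x / f x) (toBase p) := by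
    rw [← pd_inl_comp_toBase]
    exact pd_congr_of_eventuallyEq ((eventually_christoffel_warped_inl_inr hU hG
      (hf.of_le one_le_two)).mono fun q hq => by rw [hq, if_pos rfl]) _
  have sum_base : ∑ l, christoffel (warped gB f gF) (Sum.inr k) (Sum.inr k) (Sum.inl l) p *
        christoffel (warped gB f gF) (Sum.inl l) (Sum.inl i) (Sum.inl j) p =
      (pd j (pd i f) (toBase p) - hess gB f i j (toBase p)) / f (toBase p) := by
    rw [hess, pd_pd_comm hf i j, sub_sub_cancel, Finset.sum_div]
    refine Finset.sum_congr rfl fun l _ => ?_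
    rw [christoffel_symm_of_isSemiRiemannianMetricOn hU hG, christoffel_warped_inl_inr hU hG hf',
      christoffel_warped_inl_inl_inl hdet', if_pos rfl]
    ring
  have sum_fiber : ∑ l, christoffel (warped gB f gF) (Sum.inr k) (Sum.inl j) (Sum.inr l) p *
        christoffel (warped gB f gF) (Sum.inr l) (Sum.inl i) (Sum.inr k) p =
      pd j f (toBase p) / f (toBase p) * (pd i f (toBase p) / f (toBase p)) := by
    simp [christoffel_warped_inl_inr hU hG hf']
  rw [curvatureTerm, pd_fiber, pd_mixed, pd_div (differentiableAt_pd hf i) hf' hf₀,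
    Fintype.sum_sum_type, Finset.sum_sub_distrib, Finset.sum_sub_distrib, sum_base, sum_fiber]
  simp only [christoffel_warped_inr_inl_inl hdet', mul_zero, zero_mul, Finset.sum_const_zero]
  field_simp
  ring

lemma ricci_warped_inl_inl (hU : U ∈ 𝓝 p) (hG : IsSemiRiemannianMetricOn U (warped gB f gF))
    (hf : ContDiffAt ℝ 2 f (toBase p)) (hf₀ : f (toBase p) ≠ 0) (i j : Fin n) :
    ricci (warped gB f gF) (Sum.inl i) (Sum.inl j) p =
      ricci gB i j (toBase p) - m / f (toBase p) * hess gB f i j (toBase p) := by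
  simp only [ricci_eq_sum_curvatureTerm, Fintype.sum_sum_type,
    curvatureTerm_warped_inl hU hG (hf.differentiableAt two_ne_zero),
    curvatureTerm_warped_inr hU hG hf hf₀, Finset.sum_const,
    Finset.card_univ, Fintype.card_fin, nsmul_eq_mul]
  ring

end WarpedProduct

section NullCovector

variable {ι : Type*} [Fintype ι] {ε α x : ι → ℝ}

lemma exists_dotProduct_eq (hα : α ≠ 0) (s : ℝ) : ∃ x, α ⬝ᵥ x = s := by
  classical
  obtain ⟨i, hi⟩ := Function.ne_iff.1 hα
  exact ⟨Pi.single i (s / α i), by simp [dotProduct_single, mul_div_cancel₀ _ hi]⟩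

lemma eq_zero_of_forall_mul_sq_eq_mul [Nonempty ι] (hε : ∀ i, ε i * ε i = 1)
    (hnull : semiNormSq ε α = 0) {a b : ℝ} (h : ∀ i, a * α i ^ 2 = b * ε i) : b = 0 := by
  have htrace : a * semiNormSq ε α = b * Fintype.card ι := by
    calc
      a * semiNormSq ε α = ∑ i, ε i * (a * α i ^ 2) := by
        rw [semiNormSq, Finset.mul_sum]
        exact Finset.sum_congr rfl fun i _ => by ring
      _ = ∑ i, b * (ε i * ε i) := Finset.sum_congr rfl fun i _ => by rw [h i]; ring
      _ = b * Fintype.card ι := by simp [hε, mul_comm]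
  simpa [hnull] using htrace.symm

variable [DecidableEq ι] {φ h : ℝ → ℝ}

lemma exists_hess_conformal_eq_mul_of_null (hε : ∀ i, ε i * ε i = 1)
    (hnull : semiNormSq ε α = 0) (hφ : DifferentiableAt ℝ φ (α ⬝ᵥ x)) (hφ₀ : φ (α ⬝ᵥ x) ≠ 0)
    (hh : ContDiffAt ℝ 2 h (α ⬝ᵥ x)) :
    ∃ c, ∀ i j, hess (conformal (fun y => φ (α ⬝ᵥ y)) (semiEuclidean ε))
      (fun y => h (α ⬝ᵥ y)) i j x = c * (α i * α j) :=
  ⟨_, fun i j => by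
    rw [hess_conformal_comp_dotProduct hε hφ hφ₀ hh, hnull, mul_zero, zero_mul, sub_zero]⟩

lemma exists_ricci_conformal_eq_mul_of_null (hε : ∀ i, ε i * ε i = 1)
    (hnull : semiNormSq ε α = 0) (hφ : ContDiffAt ℝ 2 φ (α ⬝ᵥ x)) (hφ₀ : φ (α ⬝ᵥ x) ≠ 0) :
    ∃ c, ∀ i j, ricci (conformal (fun y => φ (α ⬝ᵥ y)) (semiEuclidean ε)) i j x =
      c * (α i * α j) :=
  ⟨_, fun i j => by
    rw [ricci_conformal_comp_dotProduct hε hφ hφ₀, hnull, mul_zero, zero_mul, add_zero]⟩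

end NullCovector

end GRHS

theorem mainTheorem7_general {n m : ℕ} (hn : n ≠ 0)
    {ε α : Fin n → ℝ} (hε : ∀ i, ε i * ε i = 1) (hnull : GRHS.semiNormSq ε α = 0)
    {φ f h : ℝ → ℝ} {gF : (Fin m → ℝ) → Matrix (Fin m) (Fin m) ℝ} {u : (Fin m → ℝ) → ℝ}
    {U : Set (Fin n ⊕ Fin m → ℝ)} {p : Fin n ⊕ Fin m → ℝ} {lam : ℝ}
    (hφ : ContDiffAt ℝ 2 φ (α ⬝ᵥ GRHS.toBase p)) (hφ₀ : φ (α ⬝ᵥ GRHS.toBase p) ≠ 0)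
    (hf : ContDiffAt ℝ 2 f (α ⬝ᵥ GRHS.toBase p)) (hf₀ : f (α ⬝ᵥ GRHS.toBase p) ≠ 0)
    (hh : ContDiffAt ℝ 2 h (α ⬝ᵥ GRHS.toBase p))
    (hsol : GRHS.IsGRHSOn U
      (GRHS.warped (GRHS.conformal (fun x => φ (α ⬝ᵥ x)) (GRHS.semiEuclidean ε))
        (fun x => f (α ⬝ᵥ x)) gF)
      (fun q => h (α ⬝ᵥ GRHS.toBase q)) (fun q => u (GRHS.toFiber q)) lam)
    (hp : p ∈ U) :
    lam = 0 := by
  have : Nonempty (Fin n) := ⟨⟨0, Nat.pos_of_ne_zero hn⟩⟩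
  have hφ' := hφ.differentiableAt two_ne_zero
  obtain ⟨a, ha⟩ := GRHS.exists_ricci_conformal_eq_mul_of_null hε hnull hφ hφ₀
  obtain ⟨b, hb⟩ := GRHS.exists_hess_conformal_eq_mul_of_null hε hnull hφ' hφ₀ hf
  obtain ⟨c, hc⟩ := GRHS.exists_hess_conformal_eq_mul_of_null hε hnull hφ' hφ₀ hh
  obtain ⟨θ, -, heq⟩ := hsol.equations
  have base_equation (i : Fin n) :
      (a - m / f (α ⬝ᵥ GRHS.toBase p) * b + c) * α i ^ 2 =
        lam * (φ (α ⬝ᵥ GRHS.toBase p) ^ 2)⁻¹ * ε i := by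
    have hbase := (heq p hp).1 (Sum.inl i) (Sum.inl i)
    rw [GRHS.ricci_warped_inl_inl (hsol.isOpen.mem_nhds hp) hsol.metric
      (GRHS.contDiffAt_comp_dotProduct hf) hf₀, GRHS.hess_warped_inl_inl
      (hsol.metric.nondegenerate p hp) (fun x => h (α ⬝ᵥ x)), GRHS.pd_inl_comp_toFiber, ha, hb, hc,
      GRHS.warped, Matrix.fromBlocks_apply₁₁, GRHS.conformal_semiEuclidean_apply,
      Matrix.diagonal_apply_eq] at hbase
    linear_combination hbase
  have hlam := GRHS.eq_zero_of_forall_mul_sq_eq_mul hε hnull base_equation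
  simpa [hφ₀] using hlam

theorem mainTheorem7 {n m : ℕ}
    (ε : Fin n → ℝ) (hε : ∀ i, ε i = 1 ∨ ε i = -1)
    (δ : Fin m → ℝ) (hδ : ∀ j, δ j = 1 ∨ δ j = -1)
    (α : Fin n → ℝ) (hα : α ≠ 0)
    (β : Fin m → ℝ) (hβ : β ≠ 0)
    (I J : Set ℝ) (hI : IsOpen I) (hI' : I.OrdConnected) (hI₀ : I.Nonempty)
    (hJ : IsOpen J) (hJ' : J.OrdConnected) (hJ₀ : J.Nonempty)
    (φ f h τ u : ℝ → ℝ) (lam : ℝ)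
    (hφ : ContDiffOn ℝ ∞ φ I) (hφ₀ : ∀ s ∈ I, φ s ≠ 0)
    (hf : ContDiffOn ℝ ∞ f I) (hf₀ : ∀ s ∈ I, 0 < f s)
    (hh : ContDiffOn ℝ ∞ h I)
    (hτ : ContDiffOn ℝ ∞ τ J) (hτ₀ : ∀ t ∈ J, τ t ≠ 0)
    (hu : ContDiffOn ℝ ∞ u J) (hu₀ : ∃ s ∈ J, ∃ t ∈ J, u s ≠ u t)
    (hsol : GRHS.IsGRHSOn
      {p : Fin n ⊕ Fin m → ℝ | α ⬝ᵥ GRHS.toBase p ∈ I ∧ β ⬝ᵥ GRHS.toFiber p ∈ J}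
      (GRHS.warped
        (GRHS.conformal (fun x => φ (α ⬝ᵥ x)) (GRHS.semiEuclidean ε))
        (fun x => f (α ⬝ᵥ x))
        (GRHS.conformal (fun y => τ (β ⬝ᵥ y)) (GRHS.semiEuclidean δ)))
      (fun p => h (α ⬝ᵥ GRHS.toBase p))
      (fun p => u (β ⬝ᵥ GRHS.toFiber p))
      lam)
    (hnull : GRHS.semiNormSq ε α = 0) :
    lam = 0 := by
  obtain ⟨s, hs⟩ := hI₀
  obtain ⟨t, ht⟩ := hJ₀
  obtain ⟨x, rfl⟩ := GRHS.exists_dotProduct_eq hα s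
  obtain ⟨y, rfl⟩ := GRHS.exists_dotProduct_eq hβ t
  obtain ⟨i, -⟩ := Function.ne_iff.1 hα
  have contDiffAt_two {A : ℝ → ℝ} (hA : ContDiffOn ℝ ∞ A I) : ContDiffAt ℝ 2 A (α ⬝ᵥ x) :=
    contDiffAt_infty.1 (hA.contDiffAt (hI.mem_nhds hs)) 2
  exact mainTheorem7_general (u := fun z => u (β ⬝ᵥ z)) (p := Sum.elim x y) (Fin.pos i).ne'
    (fun k => mul_self_eq_one_iff.2 (hε k)) hnull (contDiffAt_two hφ) (hφ₀ _ hs)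
    (contDiffAt_two hf) (hf₀ _ hs).ne' (contDiffAt_two hh) hsol ⟨hs, ht⟩
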